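/- **Theorem 3.1 (Comparing dimensions).** Let $G$ be a group and $k$ a skew field. Let $k*G=k*_{c,\tau}G$ be a crossed product: given maps $c\colon G\to\operatorname{aut}(k)$ and $\tau\colon G\times G\to k^\times$ with $$c_g(c_h(r))=\tau(g,h)\,c_{gh}(r)\,\tau(g,h)^{-1},\qquad \tau(g,h)\,\tau(gh,l)=c_g(\tau(h,l))\,\tau(g,hl)$$ for all $g,h,l\in G$, $r\in k$, it is the free left $k$-module with basis $G$, with the biadditive multiplication determined by $(xg)\cdot(yh)=x\,c_g(y)\,\tau(g,h)\,(gh)$ for $x,y\in k$. Assume that $R:=k*G$ is prime (if $AB=0$ for two-sided ideals $A,B$ of $R$, then $A=0$ or $B=0$) and left Goldie (there is a bound on the number of summands in direct sums of nonzero left ideals of $R$, and the left annihilators $\{r\in R: rx=0\}$, $x\in R$, satisfy the ascending chain condition). Let $\dim$ be a function which assigns to every finitely generated left $R$-module a nonnegative real number and satisfies: 1. $\dim(R)=1$; 2. $\dim(M_1)=\dim(M_0)+\dim(M_2)$ for every short exact sequence $0\to M_0\to M_1\to M_2\to 0$ of finitely generated left $R$-modules; 3. if $M$ is a finitely generated left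 $R$-module with $\dim(M)=0$, then $\dim(Q)=0$ for every quotient module $Q$ of $M$. Then for every finitely presented left $R$-module $M$, $$\dim(M)=\dim^{\operatorname{Ore}}_{R}(M).$$ Here $\dim^{\operatorname{Ore}}_R$ is the generalized Ore dimension: the set $S$ of non-zero-divisors of $R$ satisfies the left Ore condition, $S^{-1}R\cong \operatorname{Mat}_d(D)$ for some skew field $D$ and some $d\ge 1$, the module $S^{-1}R\otimes_R M$ is a direct sum of a finite number $n$ of irreducible $S^{-1}R$-modules, and $\dim^{\operatorname{Ore}}_R(M)=n/d$. (That $S$, $S^{-1}R$ and $S^{-1}R\otimes_R M$ have these properties is part of the claim.) -/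

import Mathlib

open scoped nonZeroDivisors

universe u v w

/-! ### Crossed products -/

/-- The data `c`, `τ` which determine a crossed product `k ∗ G = k ∗_{c,τ} G`: maps of sets
`c : G → aut(k)` and `τ : G × G → kˣ` such that `c` is a homomorphism up to conjugation by `τ`
and `τ` is a 2-cocycle twisted by `c`. No normalization of `c` and `τ` at `1` is required. -/
structure CrossedProductData (k : Type u) [Ring k] (G : Type v) [Group G] where
  /-- the map `c` -/
  c : G → (k ≃+* k)
  /-- the map `τ` -/
  τ : G → G → kˣ
  c_comp : ∀ (g h : G) (r : k), c g (c h r) = τ g h * c (g * h) r * ((τ g h)⁻¹ : kˣ)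
  cocycle : ∀ g h l : G, (τ g h * τ (g * h) l : k) = c g (τ h l) * τ g (h * l)

/-- The crossed product `k ∗ G`: the free left `k`-module with basis `G`. Its ring structure is
determined by `(x g) (y h) = x c_g(y) τ(g,h) (gh)`, and its unit is `τ(1,1)⁻¹ 1`. -/
def CrossedProduct {k : Type u} [Ring k] {G : Type v} [Group G] (_D : CrossedProductData k G) :
    Type (max u v) :=
  G →₀ k

namespace CrossedProduct

variable {k : Type u} [Ring k] {G : Type v} [Group G] (D : CrossedProductData k G)

noncomputable instance : AddCommGroup (CrossedProduct D) :=
  inferInstanceAs (AddCommGroup (G →₀ k))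

noncomputable instance : Module k (CrossedProduct D) :=
  inferInstanceAs (Module k (G →₀ k))

/-- The element `x g` of the crossed product. -/
noncomputable def single (g : G) : k →+ CrossedProduct D :=
  Finsupp.singleAddHom g

theorem c_one (r : k) : D.c 1 r = D.τ 1 1 * r * ((D.τ 1 1)⁻¹ : kˣ) := by
  have h := D.c_comp 1 1 ((D.c 1).symm r)
  simpa using h

theorem τ_one_left (g : G) : D.τ 1 g = D.τ 1 1 := by
  have h := D.cocycle 1 1 g
  rw [c_one] at h
  simp only [one_mul] at h
  rw [mul_assoc, mul_assoc] at h
  have h' := (D.τ 1 1).isUnit.mul_left_cancel h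
  have h2 : ((D.τ 1 g)⁻¹ : kˣ) * (D.τ 1 g : k) = 1 := by simp
  have h3 : (1 : k) = ((D.τ 1 1)⁻¹ : kˣ) * (D.τ 1 g : k) :=
    (D.τ 1 g).isUnit.mul_left_cancel (by simpa using h')
  have h4 := congrArg (fun x : k => (D.τ 1 1 : k) * x) h3
  ext
  simpa using h4.symm

theorem τ_one_right (g : G) : (D.τ g 1 : k) = D.c g (D.τ 1 1) := by
  have h := D.cocycle g 1 1
  simp only [mul_one] at h
  exact (D.τ g 1).isUnit.mul_right_cancel h

/-- The multiplication, as a biadditive map. -/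
noncomputable def mulHom : CrossedProduct D →+ CrossedProduct D →+ CrossedProduct D :=
  Finsupp.liftAddHom fun g => AddMonoidHom.flip <| Finsupp.liftAddHom fun h =>
    AddMonoidHom.mk' (fun y => AddMonoidHom.mk' (fun x => single D (g * h) (x * D.c g y * D.τ g h))
      (fun x x' => by rw [add_mul, add_mul, map_add]))
      (fun y y' => by ext x : 1; simp [mul_add, add_mul])

noncomputable instance : Mul (CrossedProduct D) := ⟨fun a b => mulHom D a b⟩

noncomputable instance : One (CrossedProduct D) := ⟨single D 1 ((D.τ 1 1)⁻¹ : kˣ)⟩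

theorem one_def : (1 : CrossedProduct D) = single D 1 ((D.τ 1 1)⁻¹ : kˣ) := rfl

theorem single_mul_single (g h : G) (x y : k) :
    single D g x * single D h y = single D (g * h) (x * D.c g y * D.τ g h) := by
  change mulHom D (Finsupp.single g x) (Finsupp.single h y) = _
  erw [Finsupp.liftAddHom_apply_single]
  erw [AddMonoidHom.flip_apply, Finsupp.liftAddHom_apply_single]
  rfl

theorem induction {p : CrossedProduct D → Prop} (a : CrossedProduct D) (h0 : p 0)
    (hadd : ∀ a b, p a → p b → p (a + b)) (hs : ∀ g x, p (single D g x)) : p a :=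
  Finsupp.induction_linear a h0 hadd hs

noncomputable instance : Ring (CrossedProduct D) :=
  { (inferInstance : AddCommGroup (CrossedProduct D)),
    (inferInstance : Mul (CrossedProduct D)),
    (inferInstance : One (CrossedProduct D)) with
    left_distrib := fun a b c => map_add (mulHom D a) b c
    right_distrib := fun a b c => by
      change mulHom D (a + b) c = mulHom D a c + mulHom D b c
      rw [map_add]; rfl
    zero_mul := fun a => by change mulHom D 0 a = 0; rw [map_zero]; rfl
    mul_zero := fun a => map_zero (mulHom D a)
    mul_assoc := fun a b c => by
      have hl : ∀ a b c : CrossedProduct D, a * (b + c) = a * b + a * c :=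
        fun a b c => map_add (mulHom D a) b c
      have hr : ∀ a b c : CrossedProduct D, (a + b) * c = a * c + b * c := fun a b c => by
        change mulHom D (a + b) c = mulHom D a c + mulHom D b c
        rw [map_add]; rfl
      have h0l : ∀ a : CrossedProduct D, 0 * a = 0 := fun a => by
        change mulHom D 0 a = 0
        rw [map_zero]; rfl
      have h0r : ∀ a : CrossedProduct D, a * 0 = 0 := fun a => map_zero (mulHom D a)
      induction a using induction with
      | h0 => simp only [h0l]
      | hadd a a' ha ha' => simp only [hr, ha, ha']
      | hs g x =>
        induction b using induction with
        | h0 => simp only [h0l, h0r]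
        | hadd b b' hb hb' => simp only [hr, hl, hb, hb']
        | hs h y =>
          induction c using induction with
          | h0 => simp only [h0r]
          | hadd c c' hc hc' => simp only [hl, hc, hc']
          | hs l z =>
            simp only [single_mul_single, mul_assoc, map_mul]
            congr 1
            rw [← D.cocycle g h l, D.c_comp g h z]
            simp [mul_assoc]
    one_mul := fun a => by
      induction a using induction with
      | h0 => exact map_zero (mulHom D 1)
      | hadd a a' ha ha' => exact (map_add (mulHom D 1) a a').trans (congrArg₂ _ ha ha')
      | hs g x => rw [one_def, single_mul_single, c_one, τ_one_left D g]; simp [mul_assoc]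
    mul_one := fun a => by
      induction a using induction with
      | h0 => change mulHom D 0 1 = 0; rw [map_zero]; rfl
      | hadd a a' ha ha' =>
        refine Eq.trans ?_ (congrArg₂ (· + ·) ha ha')
        change mulHom D (a + a') 1 = mulHom D a 1 + mulHom D a' 1
        rw [map_add]; rfl
      | hs g x =>
        rw [one_def, single_mul_single, τ_one_right, mul_assoc, ← map_mul]; simp }

end CrossedProduct

/-! ### Prime left Goldie rings -/

/-- A ring is prime if `A B = 0` implies `A = 0` or `B = 0` for all two-sided ideals `A`, `B`. -/
def IsPrimeRing (R : Type u) [Ring R] : Prop :=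
  ∀ A B : TwoSidedIdeal R, (∀ a ∈ A, ∀ b ∈ B, a * b = 0) → A = ⊥ ∨ B = ⊥

/-- A ring is left Goldie if the number of summands in direct sums of nonzero left ideals is
bounded, and the left annihilators `{r | r x = 0}`, `x ∈ R`, satisfy the ascending chain
condition. (`Ideal R` is the type of left ideals of `R`.) -/
def IsLeftGoldie (R : Type u) [Ring R] : Prop :=
  (∃ d : ℕ, ∀ (n : ℕ) (I : Fin n → Ideal R), (∀ i, I i ≠ ⊥) → iSupIndep I → n ≤ d) ∧
  ∀ x : ℕ → R, (∀ n, {r : R | r * x n = 0} ⊆ {r : R | r * x (n + 1) = 0}) →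
    ∃ n, ∀ m, n ≤ m → {r : R | r * x m = 0} = {r : R | r * x n = 0}

/-! ### The generalized Ore dimension -/

open scoped TensorProduct in
/-- The left `Q`-module `Q ⊗_R M` for a homomorphism `φ : R → Q` of not necessarily commutative
rings and a left `R`-module `M`: the quotient of `Q ⊗_ℤ M` by the relations
`(q φ(r)) ⊗ m = q ⊗ (r m)`. -/
abbrev BaseExtension {R : Type u} [Ring R] {Q : Type v} [Ring Q] (φ : R →+* Q)
    (M : Type w) [AddCommGroup M] [Module R M] : Type (max v w) :=
  (Q ⊗[ℤ] M) ⧸ Submodule.span Q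
    {x : Q ⊗[ℤ] M | ∃ (q : Q) (r : R) (m : M), x = (q * φ r) ⊗ₜ[ℤ] m - q ⊗ₜ[ℤ] (r • m)}

/-- `q` is the generalized Ore dimension of the left `R`-module `M`, where `S = R⁰` is the set of
non-zero-divisors of `R`, and where `S` satisfies the left Ore condition: `S⁻¹R ≅ Mat_d(K)` for a
skew field `K` and a positive integer `d`, the `S⁻¹R`-module `S⁻¹R ⊗_R M` is a direct sum of `n`
irreducible modules, and `q = n / d`. -/
def IsOreDimension (R : Type u) [Ring R] [OreLocalization.OreSet R⁰]
    (M : Type v) [AddCommGroup M] [Module R M] (q : ℝ) : Prop :=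
  ∃ (d n : ℕ) (K : Type u) (_ : DivisionRing K),
    0 < d ∧
    Nonempty (OreLocalization R⁰ R ≃+* Matrix (Fin d) (Fin d) K) ∧
    (∃ N : Fin n → Submodule (OreLocalization R⁰ R)
        (BaseExtension (OreLocalization.numeratorRingHom : R →+* OreLocalization R⁰ R) M),
      (∀ i, IsSimpleModule (OreLocalization R⁰ R) (N i)) ∧ DirectSum.IsInternal N) ∧
    q = n / d

section WellDefined

open scoped Matrix.Module

theorem isSimpleModule_column (K : Type u) [DivisionRing K] (d : ℕ) (hd : 0 < d) :
    IsSimpleModule (Matrix (Fin d) (Fin d) K) (Fin d → K) := by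
  have : Nonempty (Fin d) := ⟨⟨0, hd⟩⟩
  rw [isSimpleModule_iff_toSpanSingleton_surjective]
  refine ⟨inferInstance, fun v hv y => ?_⟩
  obtain ⟨j, hj⟩ : ∃ j, v j ≠ 0 := by
    by_contra! h
    exact hv (funext h)
  refine ⟨Matrix.of fun i l => if l = j then y i * (v j)⁻¹ else 0, ?_⟩
  ext i
  simp [Matrix.Module.smul_apply, mul_assoc, inv_mul_cancel₀ hj]

theorem length_matrix (K : Type u) [DivisionRing K] (d : ℕ) (hd : 0 < d) :
    Module.length (Matrix (Fin d) (Fin d) K) (Matrix (Fin d) (Fin d) K) = d := by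
  have := isSimpleModule_column K d hd
  let e : Matrix (Fin d) (Fin d) K →ₗ[Matrix (Fin d) (Fin d) K] (Fin d →₀ (Fin d → K)) :=
    { toFun := fun A => Finsupp.equivFunOnFinite.symm fun j i => A i j
      map_add' := fun A B => by ext; simp
      map_smul' := fun A B => by ext; simp [Matrix.mul_apply] }
  have he : Function.Bijective e := by
    constructor
    · intro A B h
      ext i j
      exact congrFun (DFunLike.congr_fun h j) i
    · intro f
      exact ⟨Matrix.of fun i j => f j i, by ext; simp [e]⟩
  rw [(LinearEquiv.ofBijective e he).length_eq, Module.length_finsupp, Module.length_eq_one]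
  simp

theorem length_of_ringEquiv_matrix {Q : Type v} [Ring Q] {K : Type u} [DivisionRing K] {d : ℕ}
    (hd : 0 < d) (e : Q ≃+* Matrix (Fin d) (Fin d) K) : Module.length Q Q = d := by
  rw [← length_matrix K d hd, Module.length_eq_height, Module.length_eq_height]
  let o : Ideal Q ≃o Ideal (Matrix (Fin d) (Fin d) K) :=
    (RingEquiv.idealComapOrderIso e).symm
  rw [← Order.height_orderIso o ⊤, map_top]

theorem length_of_isInternal {Q : Type v} [Ring Q] {X : Type w} [AddCommGroup X] [Module Q X]
    {n : ℕ} (N : Fin n → Submodule Q X) (hs : ∀ i, IsSimpleModule Q (N i))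
    (hN : DirectSum.IsInternal N) : Module.length Q X = n := by
  rw [← (LinearEquiv.ofBijective (DirectSum.coeLinearMap N) hN).length_eq,
    ((DirectSum.linearEquivFunOnFintype Q (Fin n) fun i => N i)).length_eq,
    Module.length_pi_of_fintype]
  simp [Module.length_eq_one]

/-- The generalized Ore dimension is well defined. -/
theorem IsOreDimension.unique {R : Type u} [Ring R] [OreLocalization.OreSet R⁰]
    {M : Type v} [AddCommGroup M] [Module R M] {q q' : ℝ}
    (h : IsOreDimension R M q) (h' : IsOreDimension R M q') : q = q' := by
  obtain ⟨d, n, K, _, hd, ⟨e⟩, ⟨N, hs, hN⟩, rfl⟩ := h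
  obtain ⟨d', n', K', _, hd', ⟨e'⟩, ⟨N', hs', hN'⟩, rfl⟩ := h'
  have h1 := (length_of_ringEquiv_matrix hd e).symm.trans (length_of_ringEquiv_matrix hd' e')
  have h2 := (length_of_isInternal N hs hN).symm.trans (length_of_isInternal N' hs' hN')
  norm_cast at h1 h2
  rw [h1, h2]

end WellDefined

/-! By Goldie's theorem the set `S` of regular elements of `R` is left Ore and `Q = S⁻¹R` is simple
Artinian, so `Q` has a single simple module `T`, and `Q ≅ T^d`. If `X = Q ⊗ M ≅ T^n`, then `X^d` and
`Q^n` are both `T^(nd)`, hence isomorphic. Clearing denominators in a basis of `X^d` gives an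
embedding `R^n → M^d` with `S`-torsion cokernel (`FractionModule.exists_injective_of_linearEquiv`).
A finitely generated torsion module has dimension zero (`eq_zero_of_torsion`), so additivity gives
`d · dim M = n`.

Goldie's theorem rests on two facts. The left singular ideal vanishes, so a zero left annihilator
already makes an element regular (`IsPrimeRing.mem_nonZeroDivisors`). Every essential left ideal
contains a regular element (`IsPrimeRing.exists_mem_nonZeroDivisors`); as regular elements become
units in `Q`, this yields the Ore condition, semisimplicity and simplicity. -/

/-! ### Prime left Goldie rings: regular elements and the Ore condition -/

/-- A left ideal `E` is essential if every nonzero element has a nonzero left multiple in `E`. -/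
def IsEssentialLeftIdeal {R : Type u} [Ring R] (E : Ideal R) : Prop :=
  ∀ x : R, x ≠ 0 → ∃ r : R, r * x ≠ 0 ∧ r * x ∈ E

/-- The left annihilator of an element, as a left ideal. -/
def leftAnnihilator {R : Type u} [Ring R] (x : R) : Ideal R :=
  LinearMap.ker (LinearMap.toSpanSingleton R R x)

theorem mem_leftAnnihilator {R : Type u} [Ring R] {x r : R} :
    r ∈ leftAnnihilator x ↔ r * x = 0 := by
  simp [leftAnnihilator]

theorem IsEssentialLeftIdeal.mono {R : Type u} [Ring R] {E F : Ideal R}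
    (hE : IsEssentialLeftIdeal E) (h : E ≤ F) : IsEssentialLeftIdeal F := fun x hx =>
  let ⟨r, hr, hr'⟩ := hE x hx
  ⟨r, hr, h hr'⟩

/-- Applied to `E = Rs`, this makes `{t | t a ∈ Rs}` essential; a regular element in it is the
denominator that the Ore condition asks for. -/
theorem IsEssentialLeftIdeal.comap_mulRight {R : Type u} [Ring R] {E : Ideal R}
    (hE : IsEssentialLeftIdeal E) (a : R) :
    IsEssentialLeftIdeal (Submodule.comap (LinearMap.toSpanSingleton R R a) E) := by
  intro y hy
  by_cases hya : y * a = 0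
  · exact ⟨1, by simpa using hy, by simp [hya]⟩
  · obtain ⟨t, ht, htE⟩ := hE _ hya
    refine ⟨t, fun h => ht ?_, ?_⟩
    · rw [← mul_assoc, h, zero_mul]
    · simpa [mul_assoc] using htE

/-- The left annihilator `A` of `Rb` and the right annihilator `B` of `A` are two-sided, `AB = 0`,
and they contain `a` and `b` respectively. -/
theorem IsPrimeRing.eq_zero_or_eq_zero {R : Type u} [Ring R] (hR : IsPrimeRing R) {a b : R}
    (h : ∀ r, a * r * b = 0) : a = 0 ∨ b = 0 := by
  let A : TwoSidedIdeal R := TwoSidedIdeal.mk' {x | ∀ r, x * r * b = 0}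
    (by simp) (fun hx hy r => by rw [add_mul, add_mul, hx r, hy r, add_zero])
    (fun hx r => by rw [neg_mul, neg_mul, hx r, neg_zero])
    (fun {x y} hy r => by rw [mul_assoc x, mul_assoc x, hy r, mul_zero])
    (fun {x y} hx r => by rw [mul_assoc x]; exact hx _)
  let B : TwoSidedIdeal R := TwoSidedIdeal.mk' {y | ∀ x ∈ A, x * y = 0}
    (by simp) (fun hx hy r hr => by rw [mul_add, hx r hr, hy r hr, add_zero])
    (fun hx r hr => by rw [mul_neg, hx r hr, neg_zero])
    (fun {x y} hy r hr => by rw [← mul_assoc]; exact hy _ (A.mul_mem_right _ _ hr))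
    (fun {x y} hx r hr => by rw [← mul_assoc, hx r hr, zero_mul])
  have haA : a ∈ A := (TwoSidedIdeal.mem_mk' ..).2 h
  have hbB : b ∈ B := (TwoSidedIdeal.mem_mk' ..).2 fun x hx => by
    simpa using (TwoSidedIdeal.mem_mk' ..).1 hx 1
  refine (hR A B fun x hx y hy => (TwoSidedIdeal.mem_mk' ..).1 hy x hx).imp ?_ ?_
  · exact fun hA => by rw [hA] at haA; exact (TwoSidedIdeal.mem_bot R).1 haA
  · exact fun hB => by rw [hB] at hbB; exact (TwoSidedIdeal.mem_bot R).1 hbB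

theorem IsLeftGoldie.exists_maximal_leftAnnihilator {R : Type u} [Ring R] (hR : IsLeftGoldie R)
    (p : R → Prop) (hp : ∃ x, p x) :
    ∃ x, p x ∧ ∀ y, p y → leftAnnihilator x ≤ leftAnnihilator y →
      leftAnnihilator y ≤ leftAnnihilator x := by
  by_contra! hcon
  obtain ⟨x₀, h₀⟩ := hp
  choose f hf hle hnle using hcon
  let g : ℕ → {x // p x} := fun n => Nat.rec ⟨x₀, h₀⟩ (fun _ x => ⟨f x.1 x.2, hf x.1 x.2⟩) n
  obtain ⟨n, hn⟩ := hR.2 (fun n => (g n).1) fun n r hr =>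
    mem_leftAnnihilator.1 (hle (g n).1 (g n).2 (mem_leftAnnihilator.2 hr))
  refine hnle (g n).1 (g n).2 fun r hr => ?_
  have := hn (n + 1) (by lia)
  exact mem_leftAnnihilator.2 (this.subset (mem_leftAnnihilator.1 hr))

/-- Independence of the left ideals `R b i` in terms of elements. Sequences indexed by `ℕ` allow
induction on `n`. -/
theorem IsLeftGoldie.exists_card_bound {R : Type u} [Ring R] (hR : IsLeftGoldie R) :
    ∃ d : ℕ, ∀ (n : ℕ) (b : ℕ → R), (∀ i < n, b i ≠ 0) →
      (∀ r : ℕ → R, ∑ i ∈ Finset.range n, r i * b i = 0 → ∀ i < n, r i * b i = 0) → n ≤ d := by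
  obtain ⟨⟨d, hd⟩, -⟩ := hR
  refine ⟨d, fun n b hb h => hd n (fun i => Ideal.span {b i}) (fun i => ?_) ?_⟩
  · simpa using hb i i.2
  · classical
    rw [iSupIndep_iff_finsetSum_eq_zero_imp_eq_zero]
    intro s v hv hv0
    have hv' : ∀ j : Fin n, ∃ t, t * b j = if j ∈ s then v j else 0 := fun j => by
      split_ifs with hj
      · exact Ideal.mem_span_singleton'.1 (hv j hj)
      · exact ⟨0, zero_mul _⟩
    choose t ht using hv'
    have hr := h (fun j => if hj : j < n then t ⟨j, hj⟩ else 0) (by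
      rw [Finset.sum_range]
      simpa [ht] using hv0)
    intro i hi
    simpa [ht, hi] using hr i i.2

theorem IsLeftGoldie.isEssential_span_singleton {R : Type u} [Ring R] (hR : IsLeftGoldie R)
    {c : R} (hc : ∀ r, r * c = 0 → r = 0) : IsEssentialLeftIdeal (Ideal.span {c}) := by
  intro x hx
  by_contra! hcon
  have hpow : ∀ (n : ℕ) (r : R), r * c ^ n = 0 → r = 0 := fun n => by
    induction n with
    | zero => simp
    | succ n ih => exact fun r hr => ih r (hc _ (by rw [mul_assoc, ← pow_succ, hr]))
  obtain ⟨d, hd⟩ := hR.exists_card_bound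
  -- If `Rx ∩ Rc = 0`, then `Rx, Rxc, Rxc², …` are independent: the zeroth term of a relation lies
  -- in `Rx ∩ Rc`, so it vanishes, and `c` cancels from the rest.
  have key : ∀ (n : ℕ) (r : ℕ → R), ∑ i ∈ Finset.range n, r i * (x * c ^ i) = 0 →
      ∀ i < n, r i * (x * c ^ i) = 0 := by
    intro n
    induction n with
    | zero => simp
    | succ n ih =>
      intro r hr
      rw [Finset.sum_range_succ'] at hr
      have h1 : ∑ i ∈ Finset.range n, r (i + 1) * (x * c ^ (i + 1)) =
          (∑ i ∈ Finset.range n, r (i + 1) * (x * c ^ i)) * c := by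
        rw [Finset.sum_mul]
        exact Finset.sum_congr rfl fun i _ => by rw [pow_succ]; simp only [mul_assoc]
      rw [h1, pow_zero, mul_one] at hr
      have h0 : r 0 * x = 0 := by
        by_contra h0
        refine hcon _ h0 (Ideal.mem_span_singleton'.2
          ⟨-∑ i ∈ Finset.range n, r (i + 1) * (x * c ^ i), ?_⟩)
        rw [neg_mul, neg_eq_iff_add_eq_zero, hr]
      rw [h0, add_zero] at hr
      rintro (_ | i) hi
      · simpa using h0
      · rw [pow_succ, ← mul_assoc x, ← mul_assoc, ih _ (hc _ hr) i (by lia), zero_mul]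
  have := hd (d + 1) (fun i => x * c ^ i) (fun i _ h => hx (hpow i x h)) (key _)
  lia

/-- The left singular ideal of a prime left Goldie ring is zero. -/
theorem IsPrimeRing.eq_zero_of_isEssential_leftAnnihilator {R : Type u} [Ring R]
    (hR : IsPrimeRing R) (hG : IsLeftGoldie R) {x : R}
    (hx : IsEssentialLeftIdeal (leftAnnihilator x)) : x = 0 := by
  by_contra hx0
  obtain ⟨z, ⟨hz0, hz⟩, hmax⟩ := hG.exists_maximal_leftAnnihilator
    (fun z => z ≠ 0 ∧ IsEssentialLeftIdeal (leftAnnihilator z)) ⟨x, hx0, hx⟩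
  -- If `z y ≠ 0`, maximality gives `ann(z y) = ann z`; but some `r` has `r z ≠ 0` and `r z y = 0`.
  have hzz : ∀ y, IsEssentialLeftIdeal (leftAnnihilator y) → z * y = 0 := by
    intro y hy
    by_contra hzy
    obtain ⟨r, hr, hry⟩ := hy z hz0
    have hle : leftAnnihilator z ≤ leftAnnihilator (z * y) := fun s hs => by
      rw [mem_leftAnnihilator] at hs ⊢
      rw [← mul_assoc, hs, zero_mul]
    refine hr (mem_leftAnnihilator.1 (hmax _ ⟨hzy, hz.mono hle⟩ hle ?_))
    rw [mem_leftAnnihilator, ← mul_assoc]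
    exact mem_leftAnnihilator.1 hry
  refine hz0 ((hR.eq_zero_or_eq_zero (a := z) (b := z) fun r => ?_).elim id id)
  rw [mul_assoc]
  -- The left annihilator of `r z` contains `{s | s r ∈ ann z}`, which is essential.
  refine hzz _ ((hz.comap_mulRight r).mono fun s hs => ?_)
  simp only [Submodule.mem_comap, LinearMap.toSpanSingleton_apply, mem_leftAnnihilator,
    smul_eq_mul] at hs ⊢
  rw [← mul_assoc, hs]

/-- Left regular elements of a prime left Goldie ring are regular. -/
theorem IsPrimeRing.mem_nonZeroDivisors {R : Type u} [Ring R] (hR : IsPrimeRing R)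
    (hG : IsLeftGoldie R) {c : R} (hc : ∀ r, r * c = 0 → r = 0) : c ∈ R⁰ := by
  refine mem_nonZeroDivisors_iff.2 ⟨fun x hx => ?_, hc⟩
  refine hR.eq_zero_of_isEssential_leftAnnihilator hG
    ((hG.isEssential_span_singleton hc).mono ?_)
  rw [Ideal.span_le, Set.singleton_subset_iff]
  exact mem_leftAnnihilator.2 hx

/-- Nonzero left ideals of a prime left Goldie ring are not nil. -/
theorem IsPrimeRing.exists_mem_not_isNilpotent {R : Type u} [Ring R] (hR : IsPrimeRing R)
    (hG : IsLeftGoldie R) {L : Ideal R} (hL : L ≠ ⊥) : ∃ e ∈ L, ¬ IsNilpotent e := by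
  obtain ⟨a, haL, ha⟩ := Submodule.exists_mem_ne_zero_of_ne_bot hL
  -- Let `b = a y` have maximal annihilator among nonzero elements of `aR`. If `y x a` is nilpotent,
  -- so is `b x`; its last nonzero power lies in `aR` and has the annihilator of `b`, by maximality.
  -- Since `b x` kills that power, `b x b = 0`.
  obtain ⟨b, ⟨hb, y, rfl⟩, hmax⟩ := hG.exists_maximal_leftAnnihilator
    (fun b => b ≠ 0 ∧ ∃ y, b = a * y) ⟨a, ha, 1, by simp⟩
  obtain ⟨x, hx⟩ : ∃ x, a * y * x * (a * y) ≠ 0 := by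
    by_contra! h
    exact hb ((hR.eq_zero_or_eq_zero h).elim id id)
  refine ⟨y * x * a, L.mul_mem_left _ haL, fun ⟨n, hn⟩ => ?_⟩
  have hmul : ∀ m, (a * y * x) ^ (m + 1) = a * (y * x * a) ^ m * (y * x) := fun m => by
    induction m with
    | zero => simp [mul_assoc]
    | succ m ih => rw [pow_succ, ih, pow_succ]; simp only [mul_assoc]
  classical
  have hex : ∃ m, (a * y * x) ^ (m + 1) = 0 := ⟨n, by rw [hmul, hn]; simp⟩
  have h1 := Nat.find_spec hex
  set m := Nat.find hex with hm
  obtain ⟨k, hk⟩ : ∃ k, m = k + 1 := Nat.exists_eq_succ_of_ne_zero fun h0 => by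
    rw [h0, zero_add, pow_one] at h1
    exact hx (by rw [h1, zero_mul])
  have h2 : (a * y * x) ^ (k + 1) ≠ 0 := Nat.find_min hex (by lia)
  rw [hk] at h1
  refine hx (mem_leftAnnihilator.1 (hmax ((a * y * x) ^ (k + 1)) ⟨h2, ?_⟩ ?_ ?_))
  · exact ⟨y * x * (a * y * x) ^ k, by rw [pow_succ']; simp only [mul_assoc]⟩
  · intro s hs
    rw [mem_leftAnnihilator] at hs ⊢
    rw [pow_succ', ← mul_assoc, ← mul_assoc s, hs, zero_mul, zero_mul]
  · rw [mem_leftAnnihilator, ← pow_succ', h1]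

/-- The left annihilators of the powers of a non-nilpotent `e ∈ L` stabilize; a high power `a` of
`e` then satisfies `Ra ∩ ann a = 0`. -/
theorem IsPrimeRing.exists_mem_leftAnnihilator_sq {R : Type u} [Ring R] (hR : IsPrimeRing R)
    (hG : IsLeftGoldie R) {L : Ideal R} (hL : L ≠ ⊥) :
    ∃ a ∈ L, a ≠ 0 ∧ ∀ r, r * a * a = 0 → r * a = 0 := by
  obtain ⟨e, heL, he⟩ := hR.exists_mem_not_isNilpotent hG hL
  obtain ⟨N, hN⟩ := hG.2 (fun n => e ^ (n + 1)) fun n r (hr : r * _ = 0) => by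
    change r * _ = 0
    rw [pow_succ _ (n + 1), ← mul_assoc, hr, zero_mul]
  refine ⟨e ^ (N + 1), ?_, fun h => he ⟨_, h⟩, fun r hr => ?_⟩
  · rw [pow_succ]; exact L.mul_mem_left _ heL
  -- The index `n` stands for `e ^ (n + 1)`, so this index stands for the square of `e ^ (N + 1)`.
  · have := hN (N + (N + 1)) (by lia)
    refine this.subset ?_
    change r * _ = 0
    rw [← hr, mul_assoc, ← pow_add]
    congr 2; lia

/-- Essential left ideals of a prime left Goldie ring contain regular elements. -/
theorem IsPrimeRing.exists_mem_nonZeroDivisors {R : Type u} [Ring R] (hR : IsPrimeRing R)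
    (hG : IsLeftGoldie R) {E : Ideal R} (hE : IsEssentialLeftIdeal E) : ∃ c ∈ E, c ∈ R⁰ := by
  by_contra! hcon
  obtain ⟨d, hd⟩ := hG.exists_card_bound
  -- Multiplying a relation by `a i` on the right kills the later terms; the earlier ones vanish by
  -- induction, leaving `r i * a i * a i = 0`.
  have indep : ∀ (n : ℕ) (a : ℕ → R), (∀ i < n, ∀ r, r * a i * a i = 0 → r * a i = 0) →
      (∀ i < n, ∀ j < i, a i * a j = 0) → ∀ r : ℕ → R,
      ∑ i ∈ Finset.range n, r i * a i = 0 → ∀ i < n, r i * a i = 0 := by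
    intro n a hsq hlt r hr i
    induction i using Nat.strong_induction_on with
    | _ i ih =>
      intro hi
      refine hsq i hi _ ?_
      have h := congrArg (· * a i) hr
      simp only [Finset.sum_mul, zero_mul] at h
      rw [← h, Finset.sum_eq_single i]
      · intro j hj hji
        rw [Finset.mem_range] at hj
        rcases lt_or_gt_of_ne hji with h' | h'
        · rw [ih j h' hj, zero_mul]
        · rw [mul_assoc, hlt j hj i h', mul_zero]
      · exact fun h' => absurd (Finset.mem_range.2 hi) h'
  -- As long as `∑ a i ∈ E` is not regular, its left annihilator is nonzero, meets `E`, and by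
  -- independence kills every `a i`. The next element is taken there, so the sequence outgrows the
  -- Goldie bound.
  have ex : ∀ n, ∃ a : ℕ → R, (∀ i < n, a i ∈ E ∧ a i ≠ 0) ∧
      (∀ i < n, ∀ r, r * a i * a i = 0 → r * a i = 0) ∧
      (∀ i < n, ∀ j < i, a i * a j = 0) := by
    intro n
    induction n with
    | zero => exact ⟨0, by simp⟩
    | succ n ih =>
      obtain ⟨a, haE, hsq, hlt⟩ := ih
      have hc := hcon (∑ i ∈ Finset.range n, a i)
        (E.sum_mem fun i hi => (haE i (Finset.mem_range.1 hi)).1)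
      obtain ⟨r, hr, hr0⟩ : ∃ r, r * ∑ i ∈ Finset.range n, a i = 0 ∧ r ≠ 0 := by
        by_contra! h
        exact hc (hR.mem_nonZeroDivisors hG h)
      rw [Finset.mul_sum] at hr
      obtain ⟨t, ht0, htE⟩ := hE r hr0
      let L : Ideal R := E ⊓ ⨅ i : Fin n, leftAnnihilator (a i)
      have hL : L ≠ ⊥ := by
        refine Submodule.ne_bot_iff _ |>.2 ⟨t * r, ⟨htE, ?_⟩, ht0⟩
        simp only [SetLike.mem_coe, Submodule.mem_iInf, mem_leftAnnihilator]
        intro i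
        rw [mul_assoc, indep n a hsq hlt _ hr i i.2, mul_zero]
      obtain ⟨b, hbL, hb0, hb⟩ := hR.exists_mem_leftAnnihilator_sq hG hL
      have hba : ∀ i < n, b * a i = 0 := fun i hi =>
        mem_leftAnnihilator.1 ((Submodule.mem_iInf _).1 hbL.2 ⟨i, hi⟩)
      refine ⟨Function.update a n b, fun i hi => ?_, fun i hi => ?_, fun i hi j hj => ?_⟩
      · rcases (Nat.lt_succ_iff_lt_or_eq.1 hi) with h | rfl
        · rw [Function.update_of_ne h.ne]; exact haE i h
        · rw [Function.update_self]; exact ⟨hbL.1, hb0⟩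
      · rcases (Nat.lt_succ_iff_lt_or_eq.1 hi) with h | rfl
        · rw [Function.update_of_ne h.ne]; exact hsq i h
        · rw [Function.update_self]; exact hb
      · rcases (Nat.lt_succ_iff_lt_or_eq.1 hi) with h | rfl
        · rw [Function.update_of_ne h.ne, Function.update_of_ne (by lia)]; exact hlt i h j hj
        · rw [Function.update_self, Function.update_of_ne (by lia)]; exact hba j hj
  obtain ⟨a, haE, hsq, hlt⟩ := ex (d + 1)
  have := hd (d + 1) a (fun i hi => (haE i hi).2) (indep _ a hsq hlt)
  lia

/-- The regular elements of a prime left Goldie ring satisfy the left Ore condition. -/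
theorem IsPrimeRing.nonempty_oreSet {R : Type u} [Ring R] (hR : IsPrimeRing R)
    (hG : IsLeftGoldie R) : Nonempty (OreLocalization.OreSet R⁰) := by
  refine OreLocalization.nonempty_oreSet_iff.2 ⟨fun r₁ r₂ s h => ⟨1, ?_⟩, fun r s => ?_⟩
  · have h' : (r₁ - r₂) * s = 0 := by rw [sub_mul, h, sub_self]
    rw [sub_eq_zero.1 (s.2.2 _ h')]
  · obtain ⟨c, hcE, hc⟩ := hR.exists_mem_nonZeroDivisors hG
      ((hG.isEssential_span_singleton s.2.2).comap_mulRight r)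
    obtain ⟨r', hr'⟩ := Ideal.mem_span_singleton'.1 hcE
    exact ⟨r', ⟨c, hc⟩, by simpa using hr'.symm⟩

/-! ### The ring of fractions of a prime left Goldie ring -/

section Saturation

variable {R : Type u} [Ring R] [OreLocalization.OreSet R⁰]

/-- The submodule of all elements some regular multiple of which lies in `P`. -/
def Submodule.regularSaturation {M : Type v} [AddCommGroup M] [Module R M]
    (P : Submodule R M) : Submodule R M where
  carrier := {x | ∃ s : R⁰, (s : R) • x ∈ P}
  zero_mem' := ⟨1, by simp⟩
  add_mem' := by
    rintro x y ⟨s, hs⟩ ⟨t, ht⟩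
    refine ⟨OreLocalization.oreDenom (s : R) t * s, ?_⟩
    rw [Submonoid.coe_mul, smul_add]
    refine P.add_mem ?_ ?_
    · rw [mul_smul]; exact P.smul_mem _ hs
    · rw [OreLocalization.ore_eq, mul_smul]; exact P.smul_mem _ ht
  smul_mem' := by
    rintro r x ⟨s, hs⟩
    refine ⟨OreLocalization.oreDenom r s, ?_⟩
    rw [← mul_smul, OreLocalization.ore_eq, mul_smul]
    exact P.smul_mem _ hs

theorem Submodule.le_regularSaturation {M : Type v} [AddCommGroup M] [Module R M]
    (P : Submodule R M) : P ≤ P.regularSaturation := fun x hx => ⟨1, by simpa using hx⟩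

theorem OreLocalization.smul_oreDiv_self (a : R) (s : R⁰) :
    (s : R) • (a /ₒ s : OreLocalization R⁰ R) = a • 1 := by
  rw [← OreLocalization.oreDiv_one_smul, OreLocalization.smul_cancel, ← mul_one a, ← smul_eq_mul,
    ← OreLocalization.smul_oreDiv_one, OreLocalization.one_def, smul_eq_mul, mul_one]

theorem OreLocalization.one_oreDiv_mul_self (s : R⁰) :
    ((1 : R) /ₒ s * (s : R) • 1 : OreLocalization R⁰ R) = 1 := by
  rw [OreLocalization.one_def, OreLocalization.smul_oreDiv_one, smul_eq_mul, mul_one,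
    ← OreLocalization.one_def]
  exact OreLocalization.mul_inv (1 : R⁰) s

variable {X : Type v} [AddCommGroup X] [Module R X] [Module (OreLocalization R⁰ R) X]
  [IsScalarTower R (OreLocalization R⁰ R) X]

theorem OreLocalization.regular_smul_injective (s : R⁰) {x : X} (h : (s : R) • x = 0) : x = 0 := by
  have h1 : ((1 : R) /ₒ s * ((s : R) • 1) : OreLocalization R⁰ R) • x = 0 := by
    rw [mul_smul, smul_assoc, one_smul, h, smul_zero]
  rwa [OreLocalization.one_oreDiv_mul_self, one_smul] at h1

/-- The saturation of an `R`-submodule of a module over the ring of fractions. -/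
def Submodule.fractionSaturation (P : Submodule R X) : Submodule (OreLocalization R⁰ R) X where
  __ := P.regularSaturation
  smul_mem' := by
    rintro q x ⟨t, ht⟩
    induction q with | _ a s
    refine ⟨OreLocalization.oreDenom a t * s, ?_⟩
    rw [← smul_assoc, Submonoid.coe_mul, mul_smul, OreLocalization.smul_oreDiv_self, ← mul_smul,
      OreLocalization.ore_eq, smul_assoc, one_smul, mul_smul]
    exact P.smul_mem _ ht

theorem OreLocalization.eq_top_of_regular_smul_one_mem {J : Ideal (OreLocalization R⁰ R)} (s : R⁰)
    (h : (s : R) • 1 ∈ J) : J = ⊤ := by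
  rw [Ideal.eq_top_iff_one]
  have := J.mul_mem_left ((1 : R) /ₒ s) h
  rwa [OreLocalization.one_oreDiv_mul_self] at this

end Saturation

/-- Every left ideal has a complement up to an essential left ideal. -/
theorem Ideal.exists_disjoint_isEssential_sup {R : Type u} [Ring R] (I : Ideal R) :
    ∃ K : Ideal R, Disjoint I K ∧ IsEssentialLeftIdeal (I ⊔ K) := by
  obtain ⟨K, -, hK⟩ := zorn_le_nonempty₀ {K : Ideal R | Disjoint I K}
    (fun c hc hchain y hy => ⟨sSup c, (hchain.directedOn.disjoint_sSup_right).2 hc,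
      fun z hz => le_sSup hz⟩) ⊥ disjoint_bot_right
  refine ⟨K, hK.1, fun x hx => ?_⟩
  by_contra! hcon
  have h1 : Disjoint (Ideal.span {x}) (I ⊔ K) := by
    rw [Submodule.disjoint_def]
    intro y hy hy'
    obtain ⟨r, rfl⟩ := Ideal.mem_span_singleton'.1 hy
    by_contra h
    exact hcon r h hy'
  have h2 : Disjoint I (K ⊔ Ideal.span {x}) :=
    Disjoint.disjoint_sup_right_of_disjoint_sup_left hK.1 h1.symm
  have h3 : x ∈ K := hK.2 h2 le_sup_left
    ((le_sup_right : Ideal.span {x} ≤ _) (Ideal.mem_span_singleton_self x))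
  exact hcon 1 (by simpa using hx) (by simpa using (le_sup_right : K ≤ I ⊔ K) h3)

/-- Every left ideal `J` has a complement: contract `J` to `R`, choose a complement `K` there up to
an essential ideal, and extend `K`. The essential sum contains a regular element, which is a unit
among fractions. -/
theorem IsPrimeRing.isSemisimpleRing_oreLocalization {R : Type u} [Ring R] (hR : IsPrimeRing R)
    (hG : IsLeftGoldie R) [OreLocalization.OreSet R⁰] :
    IsSemisimpleRing (OreLocalization R⁰ R) := by
  refine (isSemisimpleModule_iff _ _).2 ⟨fun J => ?_⟩
  let ι : R →ₗ[R] OreLocalization R⁰ R := LinearMap.toSpanSingleton R _ 1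
  obtain ⟨K, hIK, hess⟩ := Ideal.exists_disjoint_isEssential_sup ((J.restrictScalars R).comap ι)
  refine ⟨Submodule.fractionSaturation (R := R) (Submodule.map ι K), ?_, ?_⟩
  · rw [Submodule.disjoint_def]
    rintro q hqJ ⟨s, k, hkK, hk⟩
    have hkJ : k ∈ (J.restrictScalars R).comap ι := by
      rw [Submodule.mem_comap, hk]
      exact (J.restrictScalars R).smul_mem _ hqJ
    rw [Submodule.disjoint_def.1 hIK k hkJ hkK, map_zero] at hk
    exact OreLocalization.regular_smul_injective s hk.symm
  · obtain ⟨c, hc, hcr⟩ := hR.exists_mem_nonZeroDivisors hG hess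
    obtain ⟨i, hi, k, hk, rfl⟩ := Submodule.mem_sup.1 hc
    refine codisjoint_iff.2 (OreLocalization.eq_top_of_regular_smul_one_mem ⟨_, hcr⟩ ?_)
    change ι (i + k) ∈ _
    rw [map_add]
    exact Submodule.add_mem_sup hi
      ((Submodule.map ι K).le_regularSaturation (Submodule.mem_map_of_mem (f := ι) hk))

/-- A nonzero two-sided ideal `T` contains some `a ≠ 0` of `R`. Primeness gives `a R x ≠ 0` for `x ≠
0`, so the contraction of `T` is essential and contains a regular element. -/
theorem IsPrimeRing.isSimpleRing_oreLocalization {R : Type u} [Ring R] [Nontrivial R]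
    (hR : IsPrimeRing R) (hG : IsLeftGoldie R) [OreLocalization.OreSet R⁰] :
    IsSimpleRing (OreLocalization R⁰ R) := by
  refine isSimpleRing_iff_isTwoSided_imp.2
    ⟨OreLocalization.nontrivial_of_nonZeroDivisors le_rfl, fun T hT => ?_⟩
  by_cases hbot : T = ⊥
  · exact Or.inl hbot
  refine Or.inr ?_
  let ι : R →ₗ[R] OreLocalization R⁰ R := LinearMap.toSpanSingleton R _ 1
  obtain ⟨q, hqT, hq⟩ := Submodule.exists_mem_ne_zero_of_ne_bot hbot
  obtain ⟨a, ha0, haT⟩ : ∃ a : R, a ≠ 0 ∧ a • (1 : OreLocalization R⁰ R) ∈ T := by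
    induction q with | _ a s
    refine ⟨a, ?_, ?_⟩
    · rintro rfl
      exact hq (OreLocalization.zero_oreDiv s)
    · rw [← OreLocalization.smul_oreDiv_self]
      exact (T.restrictScalars R).smul_mem _ hqT
  have hess : IsEssentialLeftIdeal ((T.restrictScalars R).comap ι) := by
    intro x hx
    obtain ⟨r, hr⟩ : ∃ r, a * r * x ≠ 0 := by
      by_contra! h
      exact (hR.eq_zero_or_eq_zero h).elim ha0 hx
    refine ⟨a * r, hr, ?_⟩
    have := T.mul_mem_right ((r * x) • 1) haT
    rw [smul_mul_assoc, one_mul, ← mul_smul, ← mul_assoc] at this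
    exact this
  obtain ⟨c, hc, hcr⟩ := hR.exists_mem_nonZeroDivisors hG hess
  exact OreLocalization.eq_top_of_regular_smul_one_mem ⟨c, hcr⟩ hc

/-! ### Additive dimension functions -/

/-- A normalized dimension function which is additive on short exact sequences of finitely
generated modules and for which quotients of modules of dimension zero have dimension zero. -/
structure IsDimensionFunction (R : Type u) [Ring R]
    (dim : ∀ (M : Type u) [AddCommGroup M] [Module R M] [Module.Finite R M], NNReal) : Prop where
  self : dim R = 1
  exact : ∀ (M₀ M₁ M₂ : Type u)
      [AddCommGroup M₀] [Module R M₀] [Module.Finite R M₀]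
      [AddCommGroup M₁] [Module R M₁] [Module.Finite R M₁]
      [AddCommGroup M₂] [Module R M₂] [Module.Finite R M₂]
      (f : M₀ →ₗ[R] M₁) (g : M₁ →ₗ[R] M₂),
      Function.Injective f → Function.Exact f g → Function.Surjective g →
      dim M₁ = dim M₀ + dim M₂
  quotient : ∀ (M : Type u) [AddCommGroup M] [Module R M] [Module.Finite R M], dim M = 0 →
      ∀ N : Submodule R M, dim (M ⧸ N) = 0

namespace IsDimensionFunction

variable {R : Type u} [Ring R]
  {dim : ∀ (M : Type u) [AddCommGroup M] [Module R M] [Module.Finite R M], NNReal}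
  {M N : Type u} [AddCommGroup M] [Module R M] [Module.Finite R M]
  [AddCommGroup N] [Module R N] [Module.Finite R N]

theorem eq_zero_of_subsingleton (h : IsDimensionFunction R dim) [Subsingleton M] : dim M = 0 := by
  simpa using h.exact M M M 0 0 (Function.injective_of_subsingleton _)
    (fun x => by simp [Subsingleton.elim x 0]) (Function.surjective_to_subsingleton _)

/-- Invariance under isomorphism is additivity with zero kernel. -/
theorem congr (h : IsDimensionFunction R dim) (e : M ≃ₗ[R] N) : dim M = dim N := by
  have := h.exact PUnit M N 0 e.toLinearMap (Function.injective_of_subsingleton _)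
    (fun x => by simpa using eq_comm) e.surjective
  rw [this, h.eq_zero_of_subsingleton, zero_add]

theorem quotient_range (h : IsDimensionFunction R dim) {f : M →ₗ[R] N} (hf : Function.Injective f) :
    dim N = dim M + dim (N ⧸ LinearMap.range f) :=
  h.exact M N _ f (LinearMap.range f).mkQ hf (LinearMap.exact_map_mkQ_range f)
    (Submodule.mkQ_surjective _)

theorem eq_zero_of_surjective (h : IsDimensionFunction R dim) (hM : dim M = 0) {f : M →ₗ[R] N}
    (hf : Function.Surjective f) :
    dim N = 0 := by
  rw [← h.congr (f.quotKerEquivOfSurjective hf), h.quotient M hM]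

variable (M) in
theorem pi_fin (h : IsDimensionFunction R dim) (n : ℕ) : dim (Fin n → M) = n * dim M := by
  induction n with
  | zero => rw [h.eq_zero_of_subsingleton]; simp
  | succ n ih =>
    rw [h.exact M (Fin (n + 1) → M) (Fin n → M) (LinearMap.single R (fun _ => M) 0)
      (LinearMap.funLeft R M Fin.succ) (Pi.single_injective (M := fun _ => M) 0) ?_
      (LinearMap.funLeft_surjective_of_injective _ _ _ (Fin.succ_injective n)), ih]
    · push_cast; ring
    · intro x
      constructor
      · intro hx
        refine ⟨x 0, funext fun i => ?_⟩
        refine Fin.cases (by simp) (fun j => ?_) i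
        simpa using (congrFun hx j).symm
      · rintro ⟨y, rfl⟩
        ext j
        simp [LinearMap.funLeft_apply]

/-- If `s i` kills the `i`-th generator, `M` is a quotient of `R^n / f(R^n)` with `f = diag(s i)`
acting on the right. As `f` is injective, that module has dimension `n - n = 0`, and the quotient
axiom passes this on to `M`. -/
theorem eq_zero_of_torsion (h : IsDimensionFunction R dim)
    (hM : ∀ x : M, ∃ s ∈ R⁰, s • x = 0) : dim M = 0 := by
  obtain ⟨n, g, hg⟩ := Module.Finite.exists_fin' R M
  choose s hs hsg using fun i : Fin n => hM (g (Pi.single i 1))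
  let f : (Fin n → R) →ₗ[R] (Fin n → R) :=
    LinearMap.pi fun i => LinearMap.toSpanSingleton R R (s i) ∘ₗ LinearMap.proj i
  have hf : Function.Injective f := by
    rw [injective_iff_map_eq_zero]
    exact fun r hr => funext fun i => (hs i).2 _ (by simpa [f] using congrFun hr i)
  have hfg : LinearMap.range f ≤ LinearMap.ker g := by
    rintro _ ⟨r, rfl⟩
    rw [LinearMap.mem_ker, pi_eq_sum_univ' (f r), map_sum]
    refine Finset.sum_eq_zero fun i _ => ?_
    rw [map_smul]
    simp [f, mul_smul, hsg]
  refine h.eq_zero_of_surjective (M := (Fin n → R) ⧸ LinearMap.range f) ?_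
    (f := (LinearMap.range f).liftQ g hfg) ?_
  · simpa using h.quotient_range hf
  · rw [← LinearMap.range_eq_top, Submodule.range_liftQ, LinearMap.range_eq_top.2 hg]

theorem eq_of_injective_of_torsion (h : IsDimensionFunction R dim) {n d : ℕ} (hd : 0 < d)
    {f : (Fin n → R) →ₗ[R] (Fin d → M)} (hf : Function.Injective f)
    (ht : ∀ x, ∃ s ∈ R⁰, s • x ∈ LinearMap.range f) :
    (dim M : ℝ) = n / d := by
  have h1 := h.quotient_range hf
  have h2 : dim ((Fin d → M) ⧸ LinearMap.range f) = 0 := by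
    refine h.eq_zero_of_torsion fun x => ?_
    obtain ⟨y, rfl⟩ := Submodule.mkQ_surjective _ x
    obtain ⟨s, hs, hsy⟩ := ht y
    exact ⟨s, hs, by rw [← map_smul]; exact (Submodule.Quotient.mk_eq_zero _).2 hsy⟩
  rw [h.pi_fin M, h.pi_fin R, h.self, h2, mul_one, add_zero] at h1
  rw [eq_div_iff (by positivity), mul_comm]
  exact_mod_cast h1

end IsDimensionFunction

/-! ### Modules over simple Artinian rings -/

theorem exists_isInternal_simple (Q : Type u) [Ring Q] (X : Type v) [AddCommGroup X] [Module Q X]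
    [IsSemisimpleModule Q X] [Module.Finite Q X] :
    ∃ (n : ℕ) (N : Fin n → Submodule Q X),
      (∀ i, IsSimpleModule Q (N i)) ∧ DirectSum.IsInternal N := by
  obtain ⟨s, hind, hsup, hs⟩ := IsSemisimpleModule.exists_sSupIndep_sSup_simples_eq_top Q X
  have : Finite s := WellFoundedGT.finite_of_iSupIndep ((sSupIndep_iff _).1 hind)
    fun N => (N.1.nontrivial_iff_ne_bot).1 ((hs N N.2).nontrivial)
  let e := Finite.equivFin s
  refine ⟨_, fun i => (e.symm i).1, fun i => hs _ (e.symm i).2,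
    DirectSum.isInternal_submodule_of_iSupIndep_of_iSup_eq_top
      (((sSupIndep_iff _).1 hind).comp e.symm.injective) ?_⟩
  rw [← hsup, sSup_eq_iSup', e.symm.iSup_comp (g := fun i => i.1)]

theorem length_fin_fun {Q : Type u} [Ring Q] {T : Type v} [AddCommGroup T] [Module Q T]
    [IsSimpleModule Q T] (n : ℕ) : Module.length Q (Fin n → T) = n := by
  rw [Module.length_pi_of_fintype]
  simp [Module.length_eq_one]

/-- Over a simple Artinian ring `Q` of length `d`, the power `X ^ d` of a finitely generated
module `X` of length `n` is free of rank `n`. -/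
theorem exists_linearEquiv_pow (Q : Type u) [Ring Q] [IsSimpleRing Q] [IsArtinianRing Q]
    (X : Type v) [AddCommGroup X] [Module Q X] [Module.Finite Q X] {d n : ℕ}
    (hd : Module.length Q Q = d) (hn : Module.length Q X = n) :
    Nonempty ((Fin d → X) ≃ₗ[Q] (Fin n → Q)) := by
  obtain ⟨d', -, T, hT, ⟨e⟩⟩ := (IsSimpleRing.isIsotypic Q Q).linearEquiv_fun
  -- A simple submodule of `X` is isomorphic to a left ideal of `Q`, hence to `T`.
  have hX : IsIsotypicOfType Q X T := fun m _ => by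
    obtain ⟨I, ⟨e'⟩⟩ := IsSemisimpleRing.exists_linearEquiv_ideal_of_isSimpleModule Q m
    have := IsSimpleModule.congr e'.symm
    exact ⟨e'.trans (IsSimpleRing.isIsotypic Q Q T I).some⟩
  obtain ⟨n', ⟨e'⟩⟩ := hX.linearEquiv_fun
  obtain rfl : d' = d := by
    rw [e.length_eq, length_fin_fun] at hd; exact_mod_cast hd
  obtain rfl : n' = n := by
    rw [e'.length_eq, length_fin_fun] at hn; exact_mod_cast hn
  let swap : (Fin d' → Fin n' → T) ≃ₗ[Q] (Fin n' → Fin d' → T) :=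
    { Equiv.piComm fun _ _ => T with
      map_add' := fun _ _ => rfl
      map_smul' := fun _ _ => rfl }
  exact ⟨(LinearEquiv.piCongrRight fun _ => e').trans
    (swap.trans (LinearEquiv.piCongrRight fun _ => e.symm))⟩

/-! ### The base extension to the ring of fractions -/

section BaseExtension

open scoped TensorProduct

variable (R : Type u) [Ring R] [OreLocalization.OreSet R⁰]
  (M : Type v) [AddCommGroup M] [Module R M]

/-- The base extension `S⁻¹R ⊗_R M`, where `S` is the set of non-zero-divisors of `R`. -/
abbrev FractionModule : Type (max v u) :=
  BaseExtension (OreLocalization.numeratorRingHom : R →+* OreLocalization R⁰ R) M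

variable {M}

namespace FractionModule

theorem numeratorRingHom_eq_smul_one (r : R) :
    (OreLocalization.numeratorRingHom r : OreLocalization R⁰ R) = r • 1 := by
  rw [OreLocalization.one_def, OreLocalization.smul_oreDiv_one, smul_eq_mul, mul_one]
  rfl

/-- The canonical map `m ↦ 1 ⊗ m`. -/
def mk : M →ₗ[R] FractionModule R M where
  toFun m := Submodule.Quotient.mk ((1 : OreLocalization R⁰ R) ⊗ₜ[ℤ] m)
  map_add' m m' := by rw [TensorProduct.tmul_add, Submodule.Quotient.mk_add]
  map_smul' r m := by
    rw [RingHom.id_apply, ← Submodule.Quotient.mk_smul, TensorProduct.smul_tmul', eq_comm,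
      Submodule.Quotient.eq]
    refine Submodule.subset_span ⟨1, r, m, ?_⟩
    rw [one_mul, numeratorRingHom_eq_smul_one]

theorem eq_top_of_forall_mk_mem {T : Submodule (OreLocalization R⁰ R) (FractionModule R M)}
    (hT : ∀ m, mk R m ∈ T) : T = ⊤ := by
  refine eq_top_iff.2 fun x _ => ?_
  obtain ⟨y, rfl⟩ := Submodule.Quotient.mk_surjective _ x
  induction y with
  | zero => exact T.zero_mem
  | add a b ha hb => exact T.add_mem (ha trivial) (hb trivial)
  | tmul q m =>
    have : (q ⊗ₜ[ℤ] m : OreLocalization R⁰ R ⊗[ℤ] M) = q • (1 ⊗ₜ[ℤ] m) := by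
      rw [TensorProduct.smul_tmul', smul_eq_mul, mul_one]
    rw [this, Submodule.Quotient.mk_smul]
    exact T.smul_mem q (hT m)

instance [Module.Finite R M] : Module.Finite (OreLocalization R⁰ R) (FractionModule R M) := by
  classical
  obtain ⟨s, hs⟩ := Module.Finite.fg_top (R := R) (M := M)
  refine ⟨⟨s.image (mk R), eq_top_of_forall_mk_mem R fun m => ?_⟩⟩
  have : Submodule.span R (s : Set M) ≤
      ((Submodule.span (OreLocalization R⁰ R) (s.image (mk R) : Set _)).restrictScalars R).comap
        (mk R) := by
    refine Submodule.span_le.2 fun m hm => Submodule.subset_span ?_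
    exact Finset.mem_coe.2 (Finset.mem_image_of_mem _ hm)
  rw [hs] at this
  exact this trivial

/-- The additive map `q ⊗ m ↦ q • (m / 1)`. -/
def tensorToOreLocalization : OreLocalization R⁰ R ⊗[ℤ] M →+ OreLocalization R⁰ M :=
  TensorProduct.liftAddHom
    (AddMonoidHom.mk' (fun q => AddMonoidHom.mk' (fun m => q • (m /ₒ 1))
      fun m m' => by rw [← OreLocalization.add_oreDiv, smul_add])
      fun q q' => by ext m; exact add_smul q q' _)
    fun z q m => by
      rw [map_zsmul, map_zsmul]
      rfl

theorem tensorToOreLocalization_tmul (q : OreLocalization R⁰ R) (m : M) :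
    tensorToOreLocalization R (q ⊗ₜ[ℤ] m) = q • (m /ₒ 1) := rfl

/-- The map `tensorToOreLocalization` as a linear map. -/
def tensorToOreLocalizationLinear :
    OreLocalization R⁰ R ⊗[ℤ] M →ₗ[OreLocalization R⁰ R] OreLocalization R⁰ M where
  toFun := tensorToOreLocalization R
  map_add' := map_add _
  map_smul' q x := by
    rw [RingHom.id_apply]
    induction x with
    | zero => simp
    | add a b ha hb => rw [smul_add, map_add, ha, hb, map_add, smul_add]
    | tmul p m =>
      rw [TensorProduct.smul_tmul', tensorToOreLocalization_tmul,
        tensorToOreLocalization_tmul, smul_eq_mul, mul_smul]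

theorem tensorToOreLocalizationLinear_tmul (q : OreLocalization R⁰ R) (m : M) :
    tensorToOreLocalizationLinear R (q ⊗ₜ[ℤ] m) = q • (m /ₒ 1) := rfl

/-- The natural map from the base extension to the Ore localization of a module. -/
def toOreLocalization :
    FractionModule R M →ₗ[OreLocalization R⁰ R] OreLocalization R⁰ M :=
  Submodule.liftQ _ (tensorToOreLocalizationLinear R) <| by
    refine Submodule.span_le.2 ?_
    rintro _ ⟨q, r, m, rfl⟩
    rw [SetLike.mem_coe, LinearMap.mem_ker, map_sub, tensorToOreLocalizationLinear_tmul,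
      tensorToOreLocalizationLinear_tmul, mul_smul, sub_eq_zero, numeratorRingHom_eq_smul_one,
      smul_assoc, one_smul, OreLocalization.smul_oreDiv_one]

/-- Vanishing of `1 ⊗ m` is tested in the Ore localization of `M`, where equality of fractions is
explicit; the map to it need not be known to be bijective. -/
theorem exists_smul_eq_zero_of_mk_eq_zero {m : M} (hm : mk R m = 0) :
    ∃ s : R⁰, (s : R) • m = 0 := by
  have h1 := congrArg (toOreLocalization R) hm
  rw [map_zero] at h1
  have h2 : (1 : OreLocalization R⁰ R) • (m /ₒ 1 : OreLocalization R⁰ M) = 0 := h1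
  rw [one_smul, ← OreLocalization.zero_oreDiv (1 : R⁰), OreLocalization.oreDiv_eq_iff] at h2
  obtain ⟨s, v, hv, hsv⟩ := h2
  refine ⟨s, ?_⟩
  rw [smul_zero] at hv
  simp only [Submonoid.coe_one, mul_one] at hsv
  rw [hsv, ← hv]

variable {R} in
-- One regular element kills all coordinates: common denominators are built into the saturation
-- being a submodule.
theorem mem_regularSaturation_pi {d : ℕ} (w : Fin d → M) (hw : ∀ j, mk R (w j) = 0) :
    w ∈ (⊥ : Submodule R (Fin d → M)).regularSaturation := by
  rw [← Finset.univ_sum_single w]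
  refine Submodule.sum_mem _ fun j _ => ?_
  obtain ⟨s, hs⟩ := exists_smul_eq_zero_of_mk_eq_zero R (hw j)
  exact ⟨s, by rw [← Pi.single_smul', hs, Pi.single_zero]; exact Submodule.zero_mem _⟩

theorem smul_one_eq_zero {r : R} (hr : r • (1 : OreLocalization R⁰ R) = 0) : r = 0 := by
  refine OreLocalization.numeratorHom_inj (S := R⁰) (fun x hx => hx.1) ?_
  rw [← numeratorRingHom_eq_smul_one, ← map_zero OreLocalization.numeratorRingHom] at hr
  exact hr

/-- If `(S⁻¹R ⊗_R M) ^ d` is free of rank `n`, then `M ^ d` contains a free module of rank `n`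
with torsion quotient. -/
theorem exists_injective_of_linearEquiv {d n : ℕ}
    (e : (Fin d → FractionModule R M) ≃ₗ[OreLocalization R⁰ R] (Fin n → OreLocalization R⁰ R)) :
    ∃ f : (Fin n → R) →ₗ[R] (Fin d → M), Function.Injective f ∧
      ∀ x, ∃ s ∈ R⁰, s • x ∈ LinearMap.range f := by
  let Q := OreLocalization R⁰ R
  let ι : (Fin d → M) →ₗ[R] (Fin d → FractionModule R M) := (mk R).compLeft (Fin d)
  let b : Fin n → Fin d → FractionModule R M := fun i => e.symm (Pi.single i 1)
  -- Every vector of the base extension has a regular multiple coming from `M^d`. For the basis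
  -- vectors `b i` these multiples define `f`.
  have hι : (LinearMap.range ι).fractionSaturation = ⊤ := by
    refine eq_top_iff.2 fun x _ => ?_
    rw [← Finset.univ_sum_single x]
    refine Submodule.sum_mem _ fun j _ => ?_
    have := eq_top_of_forall_mk_mem R (T := (LinearMap.range ι).fractionSaturation.comap
      (LinearMap.single Q (fun _ => FractionModule R M) j)) fun m => by
        refine Submodule.le_regularSaturation _ ⟨Pi.single j m, ?_⟩
        ext l
        by_cases hl : l = j
        · subst hl; simp [ι]
        · simp [ι, hl]
    exact this.ge (trivial : x j ∈ ⊤)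
  have hb : ∀ i, ∃ (s : R⁰) (m : Fin d → M), ι m = (s : R) • b i := fun i => by
    have : b i ∈ (LinearMap.range ι).fractionSaturation := by rw [hι]; trivial
    exact this
  choose s m hm using hb
  let f : (Fin n → R) →ₗ[R] (Fin d → M) := Fintype.linearCombination R m
  have hf : ∀ r, ι (f r) = ∑ i, (r i * s i) • b i := fun r => by
    simp only [f, Fintype.linearCombination_apply, map_sum, map_smul, hm]
    exact Finset.sum_congr rfl fun i _ => funext fun l => (mul_smul (r i) (s i : R) (b i l)).symm
  have hsum : ∀ x : Fin n → Q, e.symm x = ∑ i, x i • b i := fun x => by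
    conv_lhs => rw [pi_eq_sum_univ' x]
    simp only [map_sum, map_smul, b]
  refine ⟨f, ?_, fun x => ?_⟩
  · rw [injective_iff_map_eq_zero]
    intro r hr
    have h1 : e.symm (fun i => (r i * s i) • (1 : Q)) = 0 := by
      rw [hsum, ← map_zero ι, ← hr, hf]
      simp only [smul_assoc, one_smul]
    rw [LinearEquiv.map_eq_zero_iff] at h1
    exact funext fun i => (s i).2.2 _ (smul_one_eq_zero R (congrFun h1 i))
  -- The saturation contains each `b i`, since `s i • b i` is in the image. So `t • x` and `f r`
  -- agree up to the kernel of `ι`, which a further regular `t'` kills.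
  · have htop : (LinearMap.range (ι ∘ₗ f)).fractionSaturation = ⊤ := by
      refine eq_top_iff.2 fun x _ => ?_
      rw [← e.symm_apply_apply x, hsum]
      refine Submodule.sum_mem _ fun i _ => Submodule.smul_mem _ _ ⟨s i, Pi.single i 1, ?_⟩
      rw [LinearMap.comp_apply, hf, Finset.sum_eq_single i]
      · simp
      · intro j _ hj
        rw [Pi.single_eq_of_ne hj, zero_mul]
        exact funext fun l => zero_smul R (b j l)
      · simp
    obtain ⟨t, r, hr⟩ : ι x ∈ (LinearMap.range (ι ∘ₗ f)).fractionSaturation := by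
      rw [htop]; trivial
    have hw : ι ((t : R) • x - f r) = 0 := by
      rw [map_sub, map_smul, ← hr]; exact sub_self _
    obtain ⟨t', ht'⟩ := mem_regularSaturation_pi ((t : R) • x - f r) fun j => congrFun hw j
    refine ⟨t' * t, (t' * t).2, (t' : R) • r, ?_⟩
    rw [Submodule.mem_bot, smul_sub, sub_eq_zero] at ht'
    rw [map_smul, ← ht', mul_smul]

end FractionModule

end BaseExtension

/-! ### Comparison of a dimension function with the Ore dimension -/

theorem IsDimensionFunction.isOreDimension {R : Type u} [Ring R] [Nontrivial R]
    {dim : ∀ (M : Type u) [AddCommGroup M] [Module R M] [Module.Finite R M], NNReal}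
    (h : IsDimensionFunction R dim) (hR : IsPrimeRing R) (hG : IsLeftGoldie R)
    [OreLocalization.OreSet R⁰] (M : Type u) [AddCommGroup M] [Module R M] [Module.Finite R M] :
    IsOreDimension R M (dim M) := by
  have := hR.isSemisimpleRing_oreLocalization hG
  have := hR.isSimpleRing_oreLocalization hG
  obtain ⟨d, hd, K, _, ⟨e⟩⟩ :=
    IsSimpleRing.exists_ringEquiv_matrix_divisionRing (OreLocalization R⁰ R)
  have hd0 : 0 < d := Nat.pos_of_ne_zero hd.out
  obtain ⟨n, N, hs, hN⟩ := exists_isInternal_simple (OreLocalization R⁰ R) (FractionModule R M)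
  obtain ⟨e'⟩ := exists_linearEquiv_pow (OreLocalization R⁰ R) (FractionModule R M)
    (length_of_ringEquiv_matrix hd0 e) (length_of_isInternal N hs hN)
  obtain ⟨f, hf, ht⟩ := FractionModule.exists_injective_of_linearEquiv R e'
  exact ⟨d, n, K, inferInstance, hd0, ⟨e⟩, ⟨N, hs, hN⟩, h.eq_of_injective_of_torsion hd0 hf ht⟩

/-- Needed for the ring of fractions to be nonzero, hence a matrix ring of positive size. -/
instance {k : Type u} [DivisionRing k] {G : Type v} [Group G] (D : CrossedProductData k G) :
    Nontrivial (CrossedProduct D) :=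
  inferInstanceAs (Nontrivial (G →₀ k))

theorem theorem3p1 {k : Type u} [DivisionRing k] {G : Type v} [Group G]
    (D : CrossedProductData k G)
    (hprime : IsPrimeRing (CrossedProduct D)) (hGoldie : IsLeftGoldie (CrossedProduct D))
    (dim : ∀ (M : Type (max u v)) [AddCommGroup M] [Module (CrossedProduct D) M]
      [Module.Finite (CrossedProduct D) M], NNReal)
    (dim_self : dim (CrossedProduct D) = 1)
    (dim_exact : ∀ (M₀ M₁ M₂ : Type (max u v))
      [AddCommGroup M₀] [Module (CrossedProduct D) M₀] [Module.Finite (CrossedProduct D) M₀]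
      [AddCommGroup M₁] [Module (CrossedProduct D) M₁] [Module.Finite (CrossedProduct D) M₁]
      [AddCommGroup M₂] [Module (CrossedProduct D) M₂] [Module.Finite (CrossedProduct D) M₂]
      (f : M₀ →ₗ[CrossedProduct D] M₁) (g : M₁ →ₗ[CrossedProduct D] M₂),
      Function.Injective f → Function.Exact f g → Function.Surjective g →
      dim M₁ = dim M₀ + dim M₂)
    (dim_quotient : ∀ (M : Type (max u v)) [AddCommGroup M] [Module (CrossedProduct D) M]
      [Module.Finite (CrossedProduct D) M], dim M = 0 →
      ∀ N : Submodule (CrossedProduct D) M, dim (M ⧸ N) = 0) :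
    Nonempty (OreLocalization.OreSet (nonZeroDivisors (CrossedProduct D))) ∧
    ∀ [OreLocalization.OreSet (nonZeroDivisors (CrossedProduct D))]
      (M : Type (max u v)) [AddCommGroup M] [Module (CrossedProduct D) M]
      [Module.FinitePresentation (CrossedProduct D) M],
      IsOreDimension (CrossedProduct D) M (dim M) :=

  ⟨hprime.nonempty_oreSet hGoldie, fun M =>
    IsDimensionFunction.isOreDimension ⟨dim_self, dim_exact, dim_quotient⟩ hprime hGoldie M⟩
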